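/- Let $\lambda_1,\lambda_2,\lambda_3\ge 0$ with $\lambda_1^2+\lambda_2^2+\lambda_3^2=1$, let $|\psi_{gW}\rangle=\lambda_1|100\rangle+\lambda_2|010\rangle+\lambda_3|001\rangle$ be the corresponding generalized $W$ state of three qubits, and let $\psi_{gW}=|\psi_{gW}\rangle\langle\psi_{gW}|$. Write $h(x)=-x\log_2x-(1-x)\log_2(1-x)$ and $S(\rho)=-\mathrm{Tr}(\rho\log_2\rho)$, with $0\log_20=0$. The dense coding capacity of a two-qubit state $\rho_{kl}$, with sender $k$ and receiver $l$, is $C(\rho_{kl})=1+S(\rho_l)-S(\rho_{kl})$. For $\{j,k,l\}=\{1,2,3\}$ and a three-qubit state $\rho$, let qubit $j$ belong to a controller, who measures it in the basis $\{U^\dagger|0\rangle,U^\dagger|1\rangle\}$ given by a $2\times2$ unitary $U$, and let $\rho_{kl}^i$ be the state of the qubits $k,l$ after the outcome $i$, which has probability $\langle i|U\rho_jU^\dagger|i\rangle$. Put $$C_{CD}^{jkl}(\rho)=\max_U\sum_{i=0}^1\langle i|U\rho_jU^\dagger|i\rangle\,C(\rho_{kl}^i),\qquad P^{jkl}(\rho)=C_{CD}^{jkl}(\rho)-C(\rho_{kl}),\qquad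 P(\rho)=\min_{j,k,l}P^{jkl}(\rho),$$ the last minimum being over all permutations $(j,k,l)$ of $(1,2,3)$; $P^{jkl}$ is the control power and $P$ the minimal control power. Then: 1. For all $j,k,l$ the maximum that defines $C_{CD}^{jkl}(\psi_{gW})$ is attained at $U=1$, that is, the computational basis $\{|0\rangle,|1\rangle\}$ is an optimal measurement basis of the controller. 2. For all $j,k,l$, $$P^{jkl}(\psi_{gW})=(\lambda_j^2+\lambda_k^2)\,h\!\left(\frac{\lambda_j^2}{\lambda_j^2+\lambda_k^2}\right),$$ where the right-hand side is read as $0$ if $\lambda_j=\lambda_k=0$. 3. If $\lambda_l=\max\{\lambda_1,\lambda_2,\lambda_3\}$, then $$P(\psi_{gW})=P^{jkl}(\psi_{gW})=(\lambda_j^2+\lambda_k^2)\,h\!\left(\frac{\lambda_j^2}{\lambda_j^2+\lambda_k^2}\right).$$ 4. $P(\psi_{gW})=0$ if and only if some $\lambda_i=0$, and this holds if and only if $|\psi_{gW}\rangle$ is biseparable or fully separable, that is, the product of a vector of one qubit and a vector of the other two. -/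

import Mathlib

namespace DenseCoding

open scoped Matrix

noncomputable section

/-- Computational-basis labels of three qubits; the qubits are numbered by `Fin 3`. -/
abbrev Bits3 : Type := Fin 3 → Fin 2

/-- An operator on one qubit. -/
abbrev Op1 : Type := Matrix (Fin 2) (Fin 2) ℂ

/-- An operator on two qubits. -/
abbrev Op2 : Type := Matrix (Fin 2 × Fin 2) (Fin 2 × Fin 2) ℂ

/-- An operator on three qubits. -/
abbrev Op3 : Type := Matrix Bits3 Bits3 ℂ

/-- The binary entropy function `h(x) = -x log₂ x - (1 - x) log₂ (1 - x)`, with `0 log₂ 0 = 0`. -/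
def binaryEntropy (x : ℝ) : ℝ :=
  -x * Real.logb 2 x - (1 - x) * Real.logb 2 (1 - x)

/-- The von Neumann entropy `S(ρ) = -Tr(ρ log₂ ρ)` of a density matrix, where `log₂ ρ` is taken in
the functional calculus of Hermitian matrices. Since `Real.logb 2 0 = 0`, the kernel of `ρ`
contributes `0`, as usual. -/
def vonNeumannEntropy {n : Type} [Fintype n] [DecidableEq n] (ρ : Matrix n n ℂ) : ℝ :=
  -((ρ * cfc (Real.logb 2) ρ).trace).re

/-- The reduced state `ρ₂ = Tr₁ ρ₁₂` of the second of two qubits. -/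
def traceFirst (ρ : Op2) : Op1 :=
  Matrix.of fun b b' => ∑ a, ρ (a, b) (a, b')

/-- The dense coding channel capacity `C(ρ₁₂) = 1 + S(ρ₂) - S(ρ₁₂)`; the sender has the first
qubit, the receiver has the second. -/
def capacity (ρ : Op2) : ℝ :=
  1 + vonNeumannEntropy (traceFirst ρ) - vonNeumannEntropy ρ

/-- The basis label whose qubits `j, k, l` have the values `c, a, b`. A choice of distinct
`j, k, l` is given as the permutation `σ` with `j = σ 0`, `k = σ 1`, `l = σ 2`. -/
def label (σ : Equiv.Perm (Fin 3)) (c a b : Fin 2) : Bits3 :=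
  fun i => ![c, a, b] (σ.symm i)

/-- The reduced state `ρ_j = Tr_{kl} ρ₁₂₃` of the controller. -/
def controllerState (ρ : Op3) (σ : Equiv.Perm (Fin 3)) : Op1 :=
  Matrix.of fun c c' => ∑ a, ∑ b, ρ (label σ c a b) (label σ c' a b)

/-- The reduced state `ρ_{kl} = Tr_j ρ₁₂₃` of the sender (qubit `k`) and the receiver
(qubit `l`). -/
def pairState (ρ : Op3) (σ : Equiv.Perm (Fin 3)) : Op2 :=
  Matrix.of fun p q => ∑ c, ρ (label σ c p.1 p.2) (label σ c q.1 q.2)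

/-- The probability `⟨i| U ρ_j U† |i⟩` of the controller's outcome `i`, when the controller measures
qubit `j` in the basis `U†|0⟩, U†|1⟩`. -/
def outcomeProb (ρ : Op3) (σ : Equiv.Perm (Fin 3)) (U : Op1) (i : Fin 2) : ℝ :=
  ((U * controllerState ρ σ * Uᴴ) i i).re

/-- The state `ρ_{kl}^i = (⟨i|U ⊗ 1) ρ (U†|i⟩ ⊗ 1) / p_i` of sender and receiver after the outcome
`i`, with `p_i` the probability of that outcome. -/
def postState (ρ : Op3) (σ : Equiv.Perm (Fin 3)) (U : Op1) (i : Fin 2) : Op2 :=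
  ((outcomeProb ρ σ U i : ℂ)⁻¹) • Matrix.of fun p q =>
    ∑ c, ∑ c', U i c * ρ (label σ c p.1 p.2) (label σ c' q.1 q.2) * star (U i c')

/-- The average dense coding capacity of sender and receiver, if the controller measures in the
basis `U†|0⟩, U†|1⟩` and announces the outcome. -/
def averageCapacity (ρ : Op3) (σ : Equiv.Perm (Fin 3)) (U : Op1) : ℝ :=
  ∑ i, outcomeProb ρ σ U i * capacity (postState ρ σ U i)

/-- The controlled dense coding capacity `C_CD^{jkl}(ρ)`: the largest average capacity over all
`2 × 2` unitary matrices. -/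
def controlledCapacity (ρ : Op3) (σ : Equiv.Perm (Fin 3)) : ℝ :=
  ⨆ U : Matrix.unitaryGroup (Fin 2) ℂ, averageCapacity ρ σ U

/-- The control power `P^{jkl}(ρ) = C_CD^{jkl}(ρ) - C(ρ_{kl})`. -/
def controlPower (ρ : Op3) (σ : Equiv.Perm (Fin 3)) : ℝ :=
  controlledCapacity ρ σ - capacity (pairState ρ σ)

/-- The minimal control power: the minimum of `P^{jkl}(ρ)` over all permutations. -/
def minimalControlPower (ρ : Op3) : ℝ :=
  Finset.univ.inf' Finset.univ_nonempty (controlPower ρ)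

/-- The computational basis vector `|x₁x₂x₃⟩`. -/
def ket (x : Bits3) : Bits3 → ℂ := Pi.single x 1

/-- The density matrix `|ψ⟩⟨ψ|`. -/
def pureState (ψ : Bits3 → ℂ) : Op3 := Matrix.vecMulVec ψ (star ψ)

/-- The generalized W vector `λ₁|100⟩ + λ₂|010⟩ + λ₃|001⟩`. -/
def generalizedW (lam : Fin 3 → ℝ) : Bits3 → ℂ :=
  (lam 0 : ℂ) • ket ![1, 0, 0] + (lam 1 : ℂ) • ket ![0, 1, 0] + (lam 2 : ℂ) • ket ![0, 0, 1]

/-- The vector is a product of a vector of some qubit `j` and a vector of the two other qubits `k`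
and `l`, which may itself be entangled or a product: the pure state is biseparable or fully
separable. -/
def IsBiseparableOrFullySeparable (ψ : Bits3 → ℂ) : Prop :=
  ∃ (σ : Equiv.Perm (Fin 3)) (φ : Fin 2 → ℂ) (χ : Fin 2 → Fin 2 → ℂ),
    ∀ c a b, ψ (label σ c a b) = φ c * χ a b

end

end DenseCoding

namespace DenseCoding

open scoped Matrix

/-! A measurement of qubit j leaves k and l in a pure state, so an outcome of probability p has
capacity 1 + h(e), where e, 1 - e is the spectrum of the receiver. With s = |U i 0|², B = λ_k² +
λ_l² and y = λ_k²/B (when B ≠ 0), the receiver's determinant gives p² e(1 - e) = (sB)² y(1 - y), and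
sB ≤ p. Since h(x)/√(x(1 - x)) increases on (0, 1/2], this forces p h(e) ≤ sB h(y)
(`mul_binaryEntropy_le`). The weights s of the two outcomes sum to 1 because U is unitary, so no
basis exceeds 1 + B h(y), the value at U = 1.

By purity S(ρ_kl) = S(ρ_j) = h(λ_j²). The grouping rule, applied to λ_j², λ_k², λ_l² in two ways,
turns the control power into H - h(λ_l²), where H is the Shannon entropy of the three squares; this
is the claimed formula. It is least for the largest λ_l, and then vanishes exactly if λ_j or λ_k
does. -/

/-! ### Binary entropy: symmetry, monotonicity and grouping. -/

lemma binaryEntropy_eq_div (x : ℝ) : binaryEntropy x = Real.binEntropy x / Real.log 2 := by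
  rw [binaryEntropy, Real.binEntropy_eq_negMulLog_add_negMulLog_one_sub, Real.negMulLog,
    Real.negMulLog, Real.logb, Real.logb]
  ring

lemma binaryEntropy_one_sub (x : ℝ) : binaryEntropy (1 - x) = binaryEntropy x := by
  rw [binaryEntropy_eq_div, binaryEntropy_eq_div, Real.binEntropy_one_sub]

lemma binaryEntropy_zero : binaryEntropy 0 = 0 := by simp [binaryEntropy_eq_div]

lemma binaryEntropy_one : binaryEntropy 1 = 0 := by simp [binaryEntropy_eq_div]

lemma binaryEntropy_eq_zero {x : ℝ} : binaryEntropy x = 0 ↔ x = 0 ∨ x = 1 := by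
  have h2 : Real.log 2 ≠ 0 := (Real.log_pos one_lt_two).ne'
  rw [binaryEntropy_eq_div, div_eq_zero_iff, Real.binEntropy_eq_zero, or_iff_left h2]

lemma binaryEntropy_nonneg {x : ℝ} (h0 : 0 ≤ x) (h1 : x ≤ 1) : 0 ≤ binaryEntropy x := by
  rw [binaryEntropy_eq_div]
  exact div_nonneg (Real.binEntropy_nonneg h0 h1) (Real.log_pos one_lt_two).le

/-- The binary entropy increases with the distance of its argument from the ends `0` and `1`. -/
lemma binaryEntropy_le_of_le_of_le_one_sub {x y : ℝ} (h0 : 0 ≤ x) (hxy : x ≤ y)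
    (hxy' : x ≤ 1 - y) : binaryEntropy x ≤ binaryEntropy y := by
  have key : ∀ z : ℝ, x ≤ z → z ≤ 1 / 2 → binaryEntropy x ≤ binaryEntropy z := by
    intro z hxz hz
    rw [binaryEntropy_eq_div, binaryEntropy_eq_div]
    refine div_le_div_of_nonneg_right ?_ (Real.log_pos one_lt_two).le
    refine Real.binEntropy_strictMonoOn.monotoneOn ⟨h0, ?_⟩ ⟨h0.trans hxz, ?_⟩ hxz <;>
      linarith
  rcases le_total y (1 / 2) with hy | hy
  · exact key y hxy hy
  · rw [← binaryEntropy_one_sub y]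
    exact key (1 - y) hxy' (by linarith)

/-- Two numbers with the same product `x (1 - x)` have the same binary entropy. -/
lemma binaryEntropy_congr {x y : ℝ} (h : x * (1 - x) = y * (1 - y)) :
    binaryEntropy x = binaryEntropy y := by
  have : (x - y) * (x - (1 - y)) = 0 := by linear_combination -h
  rcases mul_eq_zero.mp this with h | h
  · rw [sub_eq_zero.mp h]
  · rw [sub_eq_zero.mp h, binaryEntropy_one_sub]

/-- Jensen for log: the points 1/(1 - x) and x/(1 - x), with weights (1 - 2x)/(1 - x) and x/(1 - x),
have mean 1. -/
lemma mul_log_le_one_sub_mul_log_one_sub {x : ℝ} (h0 : 0 < x) (h1 : x ≤ 1 / 2) :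
    x * Real.log x ≤ (1 - x) * Real.log (1 - x) := by
  have hx : 0 < 1 - x := by linarith
  have h2 : 0 ≤ 1 - 2 * x := by linarith
  have hsum : (1 - 2 * x) / (1 - x) + x / (1 - x) = 1 := by field_simp; ring
  have h := strictConcaveOn_log_Ioi.concaveOn.2
    (Set.mem_Ioi.mpr (show 0 < 1 / (1 - x) by positivity))
    (Set.mem_Ioi.mpr (show 0 < x / (1 - x) by positivity))
    (div_nonneg h2 hx.le) (div_nonneg h0.le hx.le) hsum
  have e : (1 - 2 * x) / (1 - x) * (1 / (1 - x)) + x / (1 - x) * (x / (1 - x)) = 1 := by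
    field_simp; ring
  simp only [smul_eq_mul] at h
  rw [e, Real.log_one, Real.log_div one_ne_zero hx.ne', Real.log_div h0.ne' hx.ne',
    Real.log_one] at h
  have h' := mul_le_mul_of_nonneg_left h hx.le
  have e' : (1 - x) * ((1 - 2 * x) / (1 - x) * (0 - Real.log (1 - x)) +
      x / (1 - x) * (Real.log x - Real.log (1 - x))) =
      x * Real.log x - (1 - x) * Real.log (1 - x) := by
    field_simp; ring
  rw [e'] at h'
  linarith

/-- The derivative has the sign of (1 - x) log (1 - x) - x log x. This ratio is the right one
because outcomes of different bases are linked through p √(e(1 - e)). -/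
lemma monotoneOn_binEntropy_div_sqrt :
    MonotoneOn (fun x : ℝ => Real.binEntropy x / √(x * (1 - x))) (Set.Ioc 0 (1 / 2)) := by
  have hd : ∀ x ∈ Set.Ioc (0 : ℝ) (1 / 2),
      HasDerivAt (fun x : ℝ => Real.binEntropy x / √(x * (1 - x)))
        (((Real.log (1 - x) - Real.log x) * √(x * (1 - x)) -
          Real.binEntropy x * ((1 * (1 - x) + x * (-1)) / (2 * √(x * (1 - x))))) /
            √(x * (1 - x)) ^ 2) x := by
    rintro x ⟨h0, h1⟩
    have hpos : 0 < x * (1 - x) := mul_pos h0 (by linarith)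
    refine (Real.hasDerivAt_binEntropy h0.ne' (by linarith)).div
      (HasDerivAt.sqrt ((hasDerivAt_id x).mul ((hasDerivAt_id x).const_sub 1)) hpos.ne')
      (Real.sqrt_pos.mpr hpos).ne'
  refine monotoneOn_of_deriv_nonneg (convex_Ioc _ _)
    (fun x hx => (hd x hx).continuousAt.continuousWithinAt)
    (fun x hx => (hd x (interior_subset hx)).differentiableAt.differentiableWithinAt) ?_
  intro x hx
  have hx' := interior_subset hx
  rw [(hd x hx').deriv]
  obtain ⟨h0, h1⟩ := hx'
  have hpos : 0 < x * (1 - x) := mul_pos h0 (by linarith)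
  have hs : 0 < √(x * (1 - x)) := Real.sqrt_pos.mpr hpos
  have hs2 : √(x * (1 - x)) ^ 2 = x * (1 - x) := Real.sq_sqrt hpos.le
  refine div_nonneg ?_ (sq_nonneg _)
  have e : (Real.log (1 - x) - Real.log x) * √(x * (1 - x)) -
      Real.binEntropy x * ((1 * (1 - x) + x * (-1)) / (2 * √(x * (1 - x)))) =
      ((1 - x) * Real.log (1 - x) - x * Real.log x) / (2 * √(x * (1 - x))) := by
    rw [Real.binEntropy_eq_negMulLog_add_negMulLog_one_sub, Real.negMulLog, Real.negMulLog]
    field_simp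
    rw [hs2]
    ring
  rw [e]
  exact div_nonneg (sub_nonneg.mpr (mul_log_le_one_sub_mul_log_one_sub h0 h1)) (by positivity)

/-- If `q ≤ p` and the spectra `p (e, 1 - e)` and `q (y, 1 - y)` have the same product, then the
first one has the smaller weighted entropy. -/
lemma mul_binaryEntropy_le {p q e y : ℝ} (hq : 0 ≤ q) (hqp : q ≤ p) (he0 : 0 ≤ e)
    (he : e ≤ 1 / 2) (hy0 : 0 ≤ y) (hy : y ≤ 1)
    (h : p ^ 2 * (e * (1 - e)) = q ^ 2 * (y * (1 - y))) :
    p * binaryEntropy e ≤ q * binaryEntropy y := by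
  wlog hy2 : y ≤ 1 / 2 generalizing y
  · have := this (y := 1 - y) (by linarith) (by linarith) (by rw [h]; ring) (by linarith)
    rwa [binaryEntropy_one_sub] at this
  have hp : 0 ≤ p := hq.trans hqp
  have hrhs : 0 ≤ q * binaryEntropy y := mul_nonneg hq (binaryEntropy_nonneg hy0 hy)
  rcases he0.eq_or_lt with rfl | he0
  · rwa [binaryEntropy_zero, mul_zero]
  rcases hp.eq_or_lt with rfl | hp
  · rwa [zero_mul]
  have hpe : 0 < e * (1 - e) := mul_pos he0 (by linarith)
  have hl : 0 < p ^ 2 * (e * (1 - e)) := by positivity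
  have hyy : 0 ≤ y * (1 - y) := mul_nonneg hy0 (by linarith)
  have hpy : 0 < y * (1 - y) := by
    rcases hyy.eq_or_lt with h' | h'
    · rw [h, ← h', mul_zero] at hl
      exact absurd hl (lt_irrefl _)
    · exact h'
  have hy0 : 0 < y := pos_of_mul_pos_left hpy (by linarith)
  have hle : e * (1 - e) ≤ y * (1 - y) := by
    have : p ^ 2 * (e * (1 - e)) ≤ p ^ 2 * (y * (1 - y)) := by
      rw [h]; gcongr
    exact le_of_mul_le_mul_left this (by positivity)
  -- t(1 - t) is increasing on [0, 1/2].
  have hey : e ≤ y := by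
    by_contra hlt
    nlinarith
  have hm := monotoneOn_binEntropy_div_sqrt ⟨he0, he⟩ ⟨hy0, hy2⟩ hey
  have hs : p * √(e * (1 - e)) = q * √(y * (1 - y)) := by
    have := congrArg Real.sqrt h
    rwa [Real.sqrt_mul (sq_nonneg p), Real.sqrt_mul (sq_nonneg q), Real.sqrt_sq hp.le,
      Real.sqrt_sq hq] at this
  have hse : 0 < √(e * (1 - e)) := Real.sqrt_pos.mpr hpe
  have hsy : 0 < √(y * (1 - y)) := Real.sqrt_pos.mpr hpy
  -- Multiplying by the common value `hs` of both weighted roots clears the denominators and leaves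
  -- the weights p and q.
  have h2 := mul_le_mul_of_nonneg_left hm (mul_nonneg hp.le hse.le)
  have e1 : p * √(e * (1 - e)) * (Real.binEntropy e / √(e * (1 - e))) = p * Real.binEntropy e := by
    field_simp
  have e2 : p * √(e * (1 - e)) * (Real.binEntropy y / √(y * (1 - y))) = q * Real.binEntropy y := by
    rw [hs]; field_simp
  simp only [e1, e2] at h2
  rw [binaryEntropy_eq_div, binaryEntropy_eq_div, ← mul_div_assoc, ← mul_div_assoc]
  exact div_le_div_of_nonneg_right h2 (Real.log_pos one_lt_two).le

/-- The grouping property of the Shannon entropy of three probabilities. -/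
lemma binaryEntropy_grouping {x y z : ℝ} (hx : 0 ≤ x) (hy : 0 ≤ y) (hz : 0 ≤ z)
    (h : x + y + z = 1) :
    binaryEntropy x + (y + z) * binaryEntropy (y / (y + z)) =
      (Real.negMulLog x + Real.negMulLog y + Real.negMulLog z) / Real.log 2 := by
  rcases (add_nonneg hy hz).eq_or_lt with h0 | h0
  · obtain rfl : y = 0 := by linarith
    obtain rfl : z = 0 := by linarith
    obtain rfl : x = 1 := by linarith
    simp [binaryEntropy_one]
  have hx1 : 1 - x = y + z := by linarith
  have hz1 : 1 - y / (y + z) = z / (y + z) := by field_simp; ring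
  have key : ∀ t : ℝ, (y + z) * Real.negMulLog (t / (y + z)) =
      Real.negMulLog t + t * Real.log (y + z) := by
    intro t
    rcases eq_or_ne t 0 with rfl | ht
    · simp
    rw [Real.negMulLog, Real.negMulLog, Real.log_div ht h0.ne']
    field_simp
    ring
  rw [binaryEntropy_eq_div, binaryEntropy_eq_div,
    Real.binEntropy_eq_negMulLog_add_negMulLog_one_sub,
    Real.binEntropy_eq_negMulLog_add_negMulLog_one_sub, hx1, hz1, ← mul_div_assoc, mul_add, key,
    key, Real.negMulLog_def]
  ring

/-! ### Von Neumann entropy through spectra and determinants. -/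

section Entropy

variable {n m : Type} [Fintype n] [DecidableEq n] [Fintype m] [DecidableEq m]

lemma trace_cfc {ρ : Matrix n n ℂ} (hρ : ρ.IsHermitian) (f : ℝ → ℝ) :
    (cfc f ρ).trace = ∑ i, (f (hρ.eigenvalues i) : ℂ) := by
  rw [hρ.cfc_eq, Matrix.IsHermitian.cfc, Unitary.conjStarAlgAut_apply, Matrix.trace_mul_comm,
    ← mul_assoc]
  simp [Matrix.trace_diagonal]

lemma vonNeumannEntropy_eq_sum {ρ : Matrix n n ℂ} (hρ : ρ.IsHermitian) :
    vonNeumannEntropy ρ = (∑ i, Real.negMulLog (hρ.eigenvalues i)) / Real.log 2 := by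
  -- The logarithm is discontinuous at 0, but every function is continuous on a finite spectrum.
  have hc : ∀ f : ℝ → ℝ, ContinuousOn f (spectrum ℝ ρ) := fun f =>
    ρ.finite_real_spectrum.continuousOn f
  have h : ρ * cfc (Real.logb 2) ρ = cfc (fun x => x * Real.logb 2 x) ρ := by
    rw [cfc_mul (fun x => x) (Real.logb 2) ρ (hc _) (hc _), cfc_id' ℝ ρ hρ.isSelfAdjoint]
  rw [vonNeumannEntropy, h, trace_cfc hρ, ← Complex.ofReal_sum, Complex.ofReal_re,
    ← Finset.sum_neg_distrib, Finset.sum_div]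
  refine Finset.sum_congr rfl fun i _ => ?_
  rw [Real.negMulLog, Real.logb]
  ring

/-- In this form the entropy depends on the characteristic polynomial alone, so matrices of
different sizes can be compared. -/
lemma vonNeumannEntropy_eq_sum_roots {ρ : Matrix n n ℂ} (hρ : ρ.IsHermitian) :
    vonNeumannEntropy ρ =
      (ρ.charpoly.roots.map fun z => Real.negMulLog z.re).sum / Real.log 2 := by
  rw [vonNeumannEntropy_eq_sum hρ, hρ.roots_charpoly_eq_eigenvalues, Multiset.map_map]
  rfl

/-- The nonzero spectra of `A B` and `B A` agree, so that the entropies agree. -/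
lemma vonNeumannEntropy_mul_comm (A : Matrix n m ℂ) (B : Matrix m n ℂ)
    (hAB : (A * B).IsHermitian) (hBA : (B * A).IsHermitian) :
    vonNeumannEntropy (A * B) = vonNeumannEntropy (B * A) := by
  have h := congrArg (fun p => (p.roots.map fun z : ℂ => Real.negMulLog z.re).sum)
    (Matrix.charpoly_mul_comm' A B)
  rw [Polynomial.roots_mul (mul_ne_zero (pow_ne_zero _ Polynomial.X_ne_zero)
      (Matrix.charpoly_monic _).ne_zero),
    Polynomial.roots_mul (mul_ne_zero (pow_ne_zero _ Polynomial.X_ne_zero)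
      (Matrix.charpoly_monic _).ne_zero)] at h
  -- The factors X^k only add roots 0, which carry no entropy.
  simp only [Polynomial.roots_X_pow, Multiset.map_add, Multiset.sum_add, Multiset.map_nsmul,
    Multiset.sum_nsmul, Multiset.map_singleton, Multiset.sum_singleton, Complex.zero_re,
    Real.negMulLog_zero, smul_zero, zero_add] at h
  rw [vonNeumannEntropy_eq_sum_roots hAB, vonNeumannEntropy_eq_sum_roots hBA, h]

/-- Column times row has the entropy of row times column, here the 1 × 1 identity. -/
lemma vonNeumannEntropy_smul_vecMulVec (v : n → ℂ) (r : ℝ)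
    (hv : (r : ℂ) * (star v ⬝ᵥ v) = 1) :
    vonNeumannEntropy ((r : ℂ) • Matrix.vecMulVec v (star v)) = 0 := by
  have hmul : (r : ℂ) • Matrix.vecMulVec v (star v) =
      Matrix.replicateCol Unit ((r : ℂ) • v) * Matrix.replicateRow Unit (star v) := by
    rw [← Matrix.smul_vecMulVec, Matrix.vecMulVec_eq Unit]
  have hone : Matrix.replicateRow Unit (star v) * Matrix.replicateCol Unit ((r : ℂ) • v) = 1 := by
    ext
    simp only [Matrix.replicateRow_mul_replicateCol_apply, dotProduct_smul, smul_eq_mul, hv]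
    simp
  have hH : ((r : ℂ) • Matrix.vecMulVec v (star v)).IsHermitian := by
    rw [Matrix.IsHermitian, Matrix.conjTranspose_smul, Matrix.conjTranspose_vecMulVec]
    simp
  rw [hmul, vonNeumannEntropy_mul_comm _ _ (hmul ▸ hH) (hone ▸ Matrix.isHermitian_one), hone,
    vonNeumannEntropy, one_mul, cfc_apply_one]
  simp

/-- A qubit state is determined up to a unitary by its determinant. -/
lemma exists_eq_binaryEntropy {ρ : Op1} (hρ : ρ.IsHermitian) (htr : ρ.trace = 1) :
    ∃ e : ℝ, e ≤ 1 / 2 ∧ ρ.det = ((e * (1 - e) : ℝ) : ℂ) ∧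
      vonNeumannEntropy ρ = binaryEntropy e := by
  have ht := hρ.trace_eq_sum_eigenvalues
  have hd := hρ.det_eq_prod_eigenvalues
  have hS := vonNeumannEntropy_eq_sum hρ
  rw [htr, Fin.sum_univ_two] at ht
  rw [Fin.prod_univ_two] at hd
  rw [Fin.sum_univ_two] at hS
  have h1 : hρ.eigenvalues 1 = 1 - hρ.eigenvalues 0 := by
    have : (1 : ℝ) = hρ.eigenvalues 0 + hρ.eigenvalues 1 := by
      simpa using congrArg Complex.re ht
    linarith
  rw [h1] at hd hS
  rw [← Real.binEntropy_eq_negMulLog_add_negMulLog_one_sub, ← binaryEntropy_eq_div] at hS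
  rcases le_total (hρ.eigenvalues 0) (1 / 2) with h | h
  · exact ⟨_, h, by rw [hd]; push_cast; rfl, hS⟩
  · refine ⟨1 - hρ.eigenvalues 0, by linarith, ?_, by rw [hS, binaryEntropy_one_sub]⟩
    rw [hd]; push_cast; simp; ring

lemma vonNeumannEntropy_eq_binaryEntropy {ρ : Op1} (hρ : ρ.IsHermitian) (htr : ρ.trace = 1)
    {x : ℝ} (hdet : ρ.det = ((x * (1 - x) : ℝ) : ℂ)) :
    vonNeumannEntropy ρ = binaryEntropy x := by
  obtain ⟨e, -, hd, hS⟩ := exists_eq_binaryEntropy hρ htr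
  rw [hS]
  refine binaryEntropy_congr ?_
  rw [hd] at hdet
  exact_mod_cast hdet

end Entropy

/-! ### Amplitudes and reduced states of the generalized W state. -/

lemma generalizedW_eq_sum (lam : Fin 3 → ℝ) (x : Bits3) :
    generalizedW lam x = ∑ i, (lam i : ℂ) * if x = Pi.single i 1 then 1 else 0 := by
  have h0 : (![1, 0, 0] : Bits3) = Pi.single 0 1 := by decide
  have h1 : (![0, 1, 0] : Bits3) = Pi.single 1 1 := by decide
  have h2 : (![0, 0, 1] : Bits3) = Pi.single 2 1 := by decide
  simp only [generalizedW, ket, h0, h1, h2, Fin.sum_univ_three, Pi.add_apply, Pi.smul_apply,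
    smul_eq_mul, Pi.single_apply]

/-- The amplitudes of a generalized W state after a relabelling of the qubits. -/
lemma generalizedW_label (lam : Fin 3 → ℝ) (σ : Equiv.Perm (Fin 3)) (c a b : Fin 2) :
    generalizedW lam (label σ c a b) = generalizedW (lam ∘ σ) ![c, a, b] := by
  rw [generalizedW_eq_sum, generalizedW_eq_sum, ← Equiv.sum_comp σ]
  refine Finset.sum_congr rfl fun i _ => ?_
  have : label σ c a b = Pi.single (σ i) 1 ↔ (![c, a, b] : Bits3) = Pi.single i 1 := by
    rw [← σ.arrowCongr (Equiv.refl _) |>.apply_eq_iff_eq (x := ![c, a, b])]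
    have e : (σ.arrowCongr (Equiv.refl (Fin 2))) (Pi.single i 1) = Pi.single (σ i) 1 := by
      ext k
      simp [Equiv.arrowCongr, Pi.single_apply, Equiv.symm_apply_eq]
    rw [e]
    rfl
  simp only [this, Function.comp_apply]

lemma generalizedW_apply (lam : Fin 3 → ℝ) (c a b : Fin 2) :
    generalizedW lam ![c, a, b] =
      if c = 1 ∧ a = 0 ∧ b = 0 then (lam 0 : ℂ) else
      if c = 0 ∧ a = 1 ∧ b = 0 then (lam 1 : ℂ) else
      if c = 0 ∧ a = 0 ∧ b = 1 then (lam 2 : ℂ) else 0 := by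
  fin_cases c <;> fin_cases a <;> fin_cases b <;>
    simp [generalizedW, ket]

lemma sum_comp_sq_eq_one {lam : Fin 3 → ℝ} (hnorm : ∑ i, lam i ^ 2 = 1)
    (σ : Equiv.Perm (Fin 3)) : lam (σ 0) ^ 2 + lam (σ 1) ^ 2 + lam (σ 2) ^ 2 = 1 := by
  rw [← hnorm, ← Equiv.sum_comp σ, Fin.sum_univ_three]

/-- The entry of the density matrix in relabelled qubits. -/
lemma pureState_label (lam : Fin 3 → ℝ) (σ : Equiv.Perm (Fin 3)) (c a b c' a' b' : Fin 2) :
    pureState (generalizedW lam) (label σ c a b) (label σ c' a' b') =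
      generalizedW (lam ∘ σ) ![c, a, b] * generalizedW (lam ∘ σ) ![c', a', b'] := by
  rw [pureState, Matrix.vecMulVec_apply, Pi.star_apply, generalizedW_label, generalizedW_label]
  congr 1
  rw [generalizedW_apply]
  split_ifs <;> simp

/-- With A the amplitude matrix (pair against controller), ρ_kl = A A†, while A† A is diagonal with
entries λ_k² + λ_l² and λ_j². -/
lemma vonNeumannEntropy_pairState {lam : Fin 3 → ℝ} (hnorm : ∑ i, lam i ^ 2 = 1)
    (σ : Equiv.Perm (Fin 3)) :
    vonNeumannEntropy (pairState (pureState (generalizedW lam)) σ) =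
      binaryEntropy (lam (σ 0) ^ 2) := by
  have hn := sum_comp_sq_eq_one hnorm σ
  let A : Matrix (Fin 2 × Fin 2) (Fin 2) ℂ :=
    Matrix.of fun p c => generalizedW (lam ∘ σ) ![c, p.1, p.2]
  have hA : Aᴴ = Aᵀ := by
    ext c p
    simp only [A, Matrix.conjTranspose_apply, Matrix.transpose_apply, Matrix.of_apply,
      generalizedW_apply]
    split_ifs <;> simp
  have hP : pairState (pureState (generalizedW lam)) σ = A * Aᴴ := by
    rw [hA]
    ext p q
    simp only [pairState, Matrix.of_apply, pureState_label, Matrix.mul_apply, A,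
      Matrix.transpose_apply]
  rw [hP, vonNeumannEntropy_mul_comm _ _ (Matrix.isHermitian_mul_conjTranspose_self A)
    (Matrix.isHermitian_conjTranspose_mul_self A)]
  have hB : Aᴴ * A = !![((lam (σ 1) ^ 2 + lam (σ 2) ^ 2 : ℝ) : ℂ), 0; 0, (lam (σ 0) ^ 2 : ℝ)] := by
    rw [hA]
    ext c c'
    fin_cases c <;> fin_cases c' <;>
      simp [A, Matrix.mul_apply, Fintype.sum_prod_type, generalizedW_apply, pow_two, add_comm]
  refine vonNeumannEntropy_eq_binaryEntropy (Matrix.isHermitian_conjTranspose_mul_self A) ?_ ?_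
  · rw [hB, Matrix.trace_fin_two_of, ← Complex.ofReal_add, ← Complex.ofReal_one]
    congr 1
    linarith
  · rw [hB, Matrix.det_fin_two_of, mul_zero, sub_zero, ← Complex.ofReal_mul]
    congr 1
    linear_combination lam (σ 0) ^ 2 * hn

lemma vonNeumannEntropy_traceFirst_pairState {lam : Fin 3 → ℝ} (hnorm : ∑ i, lam i ^ 2 = 1)
    (σ : Equiv.Perm (Fin 3)) :
    vonNeumannEntropy (traceFirst (pairState (pureState (generalizedW lam)) σ)) =
      binaryEntropy (lam (σ 2) ^ 2) := by
  have hn := sum_comp_sq_eq_one hnorm σ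
  have hB : traceFirst (pairState (pureState (generalizedW lam)) σ) =
      !![((lam (σ 0) ^ 2 + lam (σ 1) ^ 2 : ℝ) : ℂ), 0; 0, (lam (σ 2) ^ 2 : ℝ)] := by
    ext b b'
    fin_cases b <;> fin_cases b' <;>
      simp [traceFirst, pairState, pureState_label, generalizedW_apply, pow_two]
  refine vonNeumannEntropy_eq_binaryEntropy ?_ ?_ ?_
  · rw [hB]
    ext b b'
    fin_cases b <;> fin_cases b' <;> simp
  · rw [hB, Matrix.trace_fin_two_of, ← Complex.ofReal_add, ← Complex.ofReal_one]
    congr 1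
  · rw [hB, Matrix.det_fin_two_of, mul_zero, sub_zero, ← Complex.ofReal_mul]
    congr 1
    linear_combination lam (σ 2) ^ 2 * hn

lemma capacity_pairState {lam : Fin 3 → ℝ} (hnorm : ∑ i, lam i ^ 2 = 1)
    (σ : Equiv.Perm (Fin 3)) :
    capacity (pairState (pureState (generalizedW lam)) σ) =
      1 + binaryEntropy (lam (σ 2) ^ 2) - binaryEntropy (lam (σ 0) ^ 2) := by
  rw [capacity, vonNeumannEntropy_pairState hnorm, vonNeumannEntropy_traceFirst_pairState hnorm]

/-! ### Measurement by the controller. -/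

lemma outcomeProb_generalizedW (lam : Fin 3 → ℝ) (σ : Equiv.Perm (Fin 3)) (U : Op1) (i : Fin 2) :
    outcomeProb (pureState (generalizedW lam)) σ U i =
      Complex.normSq (U i 0) * (lam (σ 1) ^ 2 + lam (σ 2) ^ 2) +
        Complex.normSq (U i 1) * lam (σ 0) ^ 2 := by
  have hB : controllerState (pureState (generalizedW lam)) σ =
      !![((lam (σ 2) ^ 2 + lam (σ 1) ^ 2 : ℝ) : ℂ), 0; 0, (lam (σ 0) ^ 2 : ℝ)] := by
    ext b b'
    fin_cases b <;> fin_cases b' <;>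
      simp [controllerState, pureState_label, generalizedW_apply, pow_two]
  rw [outcomeProb, hB]
  simp [Matrix.mul_apply, Fin.sum_univ_two, Complex.normSq_apply, pow_two]
  ring

/-- The unnormalized vector of sender and receiver after an outcome of the controller whose basis
vector has the conjugate coefficients `u` and `v`. -/
def postVector (lam : Fin 3 → ℝ) (u v : ℂ) : Fin 2 × Fin 2 → ℂ :=
  fun p => u * generalizedW lam ![0, p.1, p.2] + v * generalizedW lam ![1, p.1, p.2]

lemma postState_generalizedW (lam : Fin 3 → ℝ) (σ : Equiv.Perm (Fin 3)) (U : Op1) (i : Fin 2) :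
    postState (pureState (generalizedW lam)) σ U i =
      (((outcomeProb (pureState (generalizedW lam)) σ U i)⁻¹ : ℝ) : ℂ) •
        Matrix.vecMulVec (postVector (lam ∘ σ) (U i 0) (U i 1))
          (star (postVector (lam ∘ σ) (U i 0) (U i 1))) := by
  rw [postState, Complex.ofReal_inv]
  congr 1
  ext p q
  have hstar : ∀ c a b : Fin 2, (starRingEnd ℂ) (generalizedW (lam ∘ σ) ![c, a, b]) =
      generalizedW (lam ∘ σ) ![c, a, b] := by
    intro c a b
    rw [generalizedW_apply]
    split_ifs <;> simp
  simp only [Matrix.of_apply, pureState_label, Fin.sum_univ_two, Matrix.vecMulVec_apply,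
    postVector, Pi.star_apply, RCLike.star_def, map_add, map_mul, hstar]
  ring

/-- The post-measurement states are pure, so that only the entropy of the receiver is left. -/
lemma exists_capacity_postState {lam : Fin 3 → ℝ} (σ : Equiv.Perm (Fin 3)) (U : Op1) (i : Fin 2)
    (hp : outcomeProb (pureState (generalizedW lam)) σ U i ≠ 0) :
    ∃ e : ℝ, e ≤ 1 / 2 ∧
      e * (1 - e) = (Complex.normSq (U i 0) * (lam (σ 1) * lam (σ 2)) /
        outcomeProb (pureState (generalizedW lam)) σ U i) ^ 2 ∧
      capacity (postState (pureState (generalizedW lam)) σ U i) = 1 + binaryEntropy e := by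
  set p := outcomeProb (pureState (generalizedW lam)) σ U i with hpdef
  set φ := postVector (lam ∘ σ) (U i 0) (U i 1) with hφ
  have hpc : (p : ℂ) ≠ 0 := Complex.ofReal_ne_zero.mpr hp
  have hpeq := outcomeProb_generalizedW lam σ U i
  rw [← hpdef] at hpeq
  have hn : ∀ z : ℂ, (starRingEnd ℂ) z * z = (Complex.normSq z : ℂ) := fun z => by
    rw [mul_comm, Complex.mul_conj]
  have h00 : φ (0, 0) = U i 1 * lam (σ 0) := by simp [hφ, postVector, generalizedW_apply]
  have h01 : φ (0, 1) = U i 0 * lam (σ 2) := by simp [hφ, postVector, generalizedW_apply]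
  have h10 : φ (1, 0) = U i 0 * lam (σ 1) := by simp [hφ, postVector, generalizedW_apply]
  have h11 : φ (1, 1) = 0 := by simp [hφ, postVector, generalizedW_apply]
  have hnorm : star φ ⬝ᵥ φ = (p : ℂ) := by
    simp only [dotProduct, Fintype.sum_prod_type, Fin.sum_univ_two, Pi.star_apply, h00, h01, h10,
      h11, RCLike.star_def, map_mul, Complex.conj_ofReal, map_zero]
    rw [hpeq]
    push_cast
    rw [← hn, ← hn]
    ring
  have hpure : vonNeumannEntropy (postState (pureState (generalizedW lam)) σ U i) = 0 := by
    rw [postState_generalizedW]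
    refine vonNeumannEntropy_smul_vecMulVec _ _ ?_
    rw [← hφ, ← hpdef, hnorm, Complex.ofReal_inv, inv_mul_cancel₀ hpc]
  have hred : traceFirst (postState (pureState (generalizedW lam)) σ U i) =
      ((p⁻¹ : ℝ) : ℂ) • (Matrix.of fun b b' => ∑ a, φ (a, b) * star (φ (a, b'))) := by
    rw [postState_generalizedW]
    ext b b'
    simp only [traceFirst, Matrix.of_apply, Matrix.smul_apply, Matrix.vecMulVec_apply,
      Pi.star_apply, smul_eq_mul, Finset.mul_sum, ← hφ, ← hpdef]
  have hH : (traceFirst (postState (pureState (generalizedW lam)) σ U i)).IsHermitian := by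
    rw [hred]
    ext b b'
    simp [Matrix.conjTranspose_apply, mul_comm]
  have htr : (traceFirst (postState (pureState (generalizedW lam)) σ U i)).trace = 1 := by
    rw [hred, Matrix.trace_smul, smul_eq_mul, Complex.ofReal_inv,
      inv_mul_eq_one₀ hpc, ← hnorm]
    simp only [Matrix.trace, dotProduct, Fintype.sum_prod_type, Fin.sum_univ_two, Pi.star_apply,
      Matrix.diag_apply, Matrix.of_apply]
    ring
  obtain ⟨e, he, hdet, hS⟩ := exists_eq_binaryEntropy hH htr
  refine ⟨e, he, ?_, by rw [capacity, hpure, hS, sub_zero]⟩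
  apply Complex.ofReal_injective
  -- The determinant is |φ₀₀φ₁₁ - φ₀₁φ₁₀|²/p². As φ₁₁ = 0, the amplitude with λ_j drops out.
  rw [← hdet, hred, Matrix.det_smul, Matrix.det_fin_two]
  simp only [Matrix.of_apply, Fin.sum_univ_two, h00, h01, h10, h11, RCLike.star_def, map_mul,
    Complex.conj_ofReal, map_zero, Fintype.card_fin]
  push_cast
  rw [← hn]
  ring

lemma normSq_column_add {U : Op1} (hU : U ∈ Matrix.unitaryGroup (Fin 2) ℂ) (j : Fin 2) :
    Complex.normSq (U 0 j) + Complex.normSq (U 1 j) = 1 := by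
  have h := congrFun (congrFun (Matrix.mem_unitaryGroup_iff'.mp hU) j) j
  simp only [Matrix.mul_apply, Fin.sum_univ_two, Matrix.one_apply_eq, Matrix.star_apply,
    RCLike.star_def, mul_comm (starRingEnd ℂ _), Complex.mul_conj] at h
  exact_mod_cast h

lemma sum_outcomeProb_generalizedW {lam : Fin 3 → ℝ} (hnorm : ∑ i, lam i ^ 2 = 1)
    (σ : Equiv.Perm (Fin 3)) {U : Op1} (hU : U ∈ Matrix.unitaryGroup (Fin 2) ℂ) :
    ∑ i, outcomeProb (pureState (generalizedW lam)) σ U i = 1 := by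
  have hn := sum_comp_sq_eq_one hnorm σ
  rw [Fin.sum_univ_two, outcomeProb_generalizedW, outcomeProb_generalizedW]
  linear_combination (lam (σ 1) ^ 2 + lam (σ 2) ^ 2) * normSq_column_add hU 0 +
    lam (σ 0) ^ 2 * normSq_column_add hU 1 + hn

/-- The entropy that one outcome leaves to the receiver, against its share of the entropy in the
computational basis. -/
lemma outcomeProb_mul_capacity_le {lam : Fin 3 → ℝ}
    (σ : Equiv.Perm (Fin 3)) (U : Op1) (i : Fin 2) :
    outcomeProb (pureState (generalizedW lam)) σ U i *
        capacity (postState (pureState (generalizedW lam)) σ U i) ≤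
      outcomeProb (pureState (generalizedW lam)) σ U i +
        Complex.normSq (U i 0) * ((lam (σ 1) ^ 2 + lam (σ 2) ^ 2) *
          binaryEntropy (lam (σ 1) ^ 2 / (lam (σ 1) ^ 2 + lam (σ 2) ^ 2))) := by
  have hs := Complex.normSq_nonneg (U i 0)
  have ht := Complex.normSq_nonneg (U i 1)
  have hpeq := outcomeProb_generalizedW lam σ U i
  set p := outcomeProb (pureState (generalizedW lam)) σ U i with hpdef
  set s := Complex.normSq (U i 0)
  set t := Complex.normSq (U i 1)
  set B := lam (σ 1) ^ 2 + lam (σ 2) ^ 2 with hB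
  have hB0 : 0 ≤ B := by positivity
  have hsB : s * B ≤ p := by
    rw [hpeq]; exact le_add_of_nonneg_right (by positivity)
  have hy0 : 0 ≤ lam (σ 1) ^ 2 / B := by positivity
  have hy1 : lam (σ 1) ^ 2 / B ≤ 1 := div_le_one_of_le₀ (le_add_of_nonneg_right (sq_nonneg _)) hB0
  -- An outcome of probability 0 has no normalized post-state; its left side is 0.
  rcases eq_or_ne p 0 with h0 | h0
  · rw [h0, zero_mul, zero_add]
    exact mul_nonneg hs (mul_nonneg hB0 (binaryEntropy_nonneg hy0 hy1))
  obtain ⟨e, he, hdet, hC⟩ := exists_capacity_postState σ U i h0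
  have he0 : 0 ≤ e := by
    have : 0 ≤ e * (1 - e) := hdet ▸ sq_nonneg _
    exact nonneg_of_mul_nonneg_left this (by linarith)
  rw [hC, mul_add, mul_one, ← mul_assoc]
  refine add_le_add_right (mul_binaryEntropy_le (by positivity) hsB he0 he hy0 hy1 ?_) _
  rw [hdet, ← hpdef, show Complex.normSq (U i 0) = s from rfl]
  rcases hB0.eq_or_lt with h | h
  · have h1 : lam (σ 1) = 0 := by nlinarith [sq_nonneg (lam (σ 1)), sq_nonneg (lam (σ 2))]
    simp [h1]
  · have : 1 - lam (σ 1) ^ 2 / B = lam (σ 2) ^ 2 / B := by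
      field_simp; rw [hB]; ring
    rw [this]
    field_simp

lemma averageCapacity_le {lam : Fin 3 → ℝ}
    (hnorm : ∑ i, lam i ^ 2 = 1) (σ : Equiv.Perm (Fin 3)) {U : Op1}
    (hU : U ∈ Matrix.unitaryGroup (Fin 2) ℂ) :
    averageCapacity (pureState (generalizedW lam)) σ U ≤
      1 + (lam (σ 1) ^ 2 + lam (σ 2) ^ 2) *
        binaryEntropy (lam (σ 1) ^ 2 / (lam (σ 1) ^ 2 + lam (σ 2) ^ 2)) := by
  refine (Finset.sum_le_sum fun i _ => outcomeProb_mul_capacity_le σ U i).trans_eq ?_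
  rw [Finset.sum_add_distrib, sum_outcomeProb_generalizedW hnorm σ hU, ← Finset.sum_mul,
    Fin.sum_univ_two, normSq_column_add hU, one_mul]

/-- Outcome 0 leaves λ_k|10⟩ + λ_l|01⟩ up to normalization, outcome 1 leaves the product |00⟩;
outcomes of probability 0 are treated apart. -/
lemma averageCapacity_one {lam : Fin 3 → ℝ} (hnorm : ∑ i, lam i ^ 2 = 1)
    (σ : Equiv.Perm (Fin 3)) :
    averageCapacity (pureState (generalizedW lam)) σ 1 =
      1 + (lam (σ 1) ^ 2 + lam (σ 2) ^ 2) *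
        binaryEntropy (lam (σ 1) ^ 2 / (lam (σ 1) ^ 2 + lam (σ 2) ^ 2)) := by
  have hn := sum_comp_sq_eq_one hnorm σ
  have hp0 : outcomeProb (pureState (generalizedW lam)) σ 1 0 =
      lam (σ 1) ^ 2 + lam (σ 2) ^ 2 := by
    simp [outcomeProb_generalizedW]
  have hp1 : outcomeProb (pureState (generalizedW lam)) σ 1 1 = lam (σ 0) ^ 2 := by
    simp [outcomeProb_generalizedW]
  have h0 : outcomeProb (pureState (generalizedW lam)) σ 1 0 *
      capacity (postState (pureState (generalizedW lam)) σ 1 0) =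
      (lam (σ 1) ^ 2 + lam (σ 2) ^ 2) * (1 +
        binaryEntropy (lam (σ 1) ^ 2 / (lam (σ 1) ^ 2 + lam (σ 2) ^ 2))) := by
    rcases eq_or_ne (lam (σ 1) ^ 2 + lam (σ 2) ^ 2) 0 with h | h
    · rw [hp0, h, zero_mul, zero_mul]
    obtain ⟨e, -, hdet, hC⟩ := exists_capacity_postState σ 1 0 (hp0.trans_ne h)
    rw [hC, hp0]
    congr 2
    refine binaryEntropy_congr ?_
    rw [hdet, hp0]
    simp
    field_simp
    ring
  have h1 : outcomeProb (pureState (generalizedW lam)) σ 1 1 *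
      capacity (postState (pureState (generalizedW lam)) σ 1 1) = lam (σ 0) ^ 2 := by
    rcases eq_or_ne (lam (σ 0) ^ 2) 0 with h | h
    · rw [hp1, h, zero_mul]
    obtain ⟨e, -, hdet, hC⟩ := exists_capacity_postState σ 1 1 (hp1.trans_ne h)
    rw [hC, hp1, binaryEntropy_congr (y := 0), binaryEntropy_zero, add_zero, mul_one]
    rw [hdet]
    simp
  rw [averageCapacity, Fin.sum_univ_two, h0, h1]
  linear_combination hn

/-! ### Control power and its minimum. -/

lemma controlledCapacity_generalizedW {lam : Fin 3 → ℝ}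
    (hnorm : ∑ i, lam i ^ 2 = 1) (σ : Equiv.Perm (Fin 3)) :
    controlledCapacity (pureState (generalizedW lam)) σ =
      1 + (lam (σ 1) ^ 2 + lam (σ 2) ^ 2) *
        binaryEntropy (lam (σ 1) ^ 2 / (lam (σ 1) ^ 2 + lam (σ 2) ^ 2)) := by
  have hle := fun U : Matrix.unitaryGroup (Fin 2) ℂ =>
    averageCapacity_le hnorm σ U.2
  refine le_antisymm (ciSup_le hle) ?_
  rw [← averageCapacity_one hnorm σ]
  -- The upper bound also shows that the range is bounded, which a real supremum requires.
  exact le_ciSup (f := fun U : Matrix.unitaryGroup (Fin 2) ℂ =>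
    averageCapacity (pureState (generalizedW lam)) σ U) ⟨_, Set.forall_mem_range.mpr hle⟩ 1

/-- Splitting off λ_j² or λ_l² first gives the same Shannon entropy; subtracting the two groupings
yields the formula. -/
lemma controlPower_generalizedW {lam : Fin 3 → ℝ}
    (hnorm : ∑ i, lam i ^ 2 = 1) (σ : Equiv.Perm (Fin 3)) :
    controlPower (pureState (generalizedW lam)) σ =
      (lam (σ 0) ^ 2 + lam (σ 1) ^ 2) *
        binaryEntropy (lam (σ 0) ^ 2 / (lam (σ 0) ^ 2 + lam (σ 1) ^ 2)) := by
  have hn := sum_comp_sq_eq_one hnorm σ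
  rw [controlPower, controlledCapacity_generalizedW hnorm, capacity_pairState hnorm]
  have h1 := binaryEntropy_grouping (sq_nonneg (lam (σ 0))) (sq_nonneg (lam (σ 1)))
    (sq_nonneg (lam (σ 2))) hn
  have h2 := binaryEntropy_grouping (sq_nonneg (lam (σ 2))) (sq_nonneg (lam (σ 0)))
    (sq_nonneg (lam (σ 1))) (by linarith)
  linear_combination h1 - h2

/-- Up to a term that is the same for all choices of the controller, the sender and the receiver,
the control power is `-h(λ_l²)`. -/
lemma controlPower_generalizedW_eq_sub {lam : Fin 3 → ℝ}
    (hnorm : ∑ i, lam i ^ 2 = 1) (σ : Equiv.Perm (Fin 3)) :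
    controlPower (pureState (generalizedW lam)) σ =
      (∑ i, Real.negMulLog (lam i ^ 2)) / Real.log 2 - binaryEntropy (lam (σ 2) ^ 2) := by
  have hn := sum_comp_sq_eq_one hnorm σ
  have h2 := binaryEntropy_grouping (sq_nonneg (lam (σ 2))) (sq_nonneg (lam (σ 0)))
    (sq_nonneg (lam (σ 1))) (by linarith)
  rw [controlPower_generalizedW hnorm, ← Equiv.sum_comp σ, Fin.sum_univ_three]
  linear_combination h2

/-- The task is to maximize h(λ_l²). Any other square is at most the largest one and, by
normalization, at most 1 minus it. -/
lemma controlPower_le_of_forall_le {lam : Fin 3 → ℝ} (hnonneg : ∀ i, 0 ≤ lam i)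
    (hnorm : ∑ i, lam i ^ 2 = 1) {σ : Equiv.Perm (Fin 3)} (hσ : ∀ i, lam i ≤ lam (σ 2))
    (τ : Equiv.Perm (Fin 3)) :
    controlPower (pureState (generalizedW lam)) σ ≤
      controlPower (pureState (generalizedW lam)) τ := by
  rw [controlPower_generalizedW_eq_sub hnorm,
    controlPower_generalizedW_eq_sub hnorm]
  refine sub_le_sub_left ?_ _
  rcases eq_or_ne (τ 2) (σ 2) with h | h
  · rw [h]
  refine binaryEntropy_le_of_le_of_le_one_sub (sq_nonneg _)
    (pow_le_pow_left₀ (hnonneg _) (hσ _) 2) ?_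
  have : lam (τ 2) ^ 2 + lam (σ 2) ^ 2 ≤ ∑ i, lam i ^ 2 := by
    rw [← Finset.sum_pair (f := fun i => lam i ^ 2) h]
    exact Finset.sum_le_sum_of_subset_of_nonneg (Finset.subset_univ _) fun _ _ _ => sq_nonneg _
  linarith

lemma minimalControlPower_eq {lam : Fin 3 → ℝ} (hnonneg : ∀ i, 0 ≤ lam i)
    (hnorm : ∑ i, lam i ^ 2 = 1) {σ : Equiv.Perm (Fin 3)} (hσ : ∀ i, lam i ≤ lam (σ 2)) :
    minimalControlPower (pureState (generalizedW lam)) =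
      controlPower (pureState (generalizedW lam)) σ :=
  le_antisymm (Finset.inf'_le _ (Finset.mem_univ _))
    (Finset.le_inf' _ _ fun τ _ => controlPower_le_of_forall_le hnonneg hnorm hσ τ)

lemma minimalControlPower_eq_zero_iff {lam : Fin 3 → ℝ} (hnonneg : ∀ i, 0 ≤ lam i)
    (hnorm : ∑ i, lam i ^ 2 = 1) :
    minimalControlPower (pureState (generalizedW lam)) = 0 ↔ ∃ i, lam i = 0 := by
  obtain ⟨l, hl⟩ := Finite.exists_max lam
  -- Any permutation with the largest coefficient at the receiver serves.
  let σ : Equiv.Perm (Fin 3) := Equiv.swap 2 l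
  have hσ2 : σ 2 = l := Equiv.swap_apply_left 2 l
  have hσ : ∀ i, lam i ≤ lam (σ 2) := by rwa [hσ2]
  have hn := sum_comp_sq_eq_one hnorm σ
  have hpos : lam (σ 2) ≠ 0 := by
    intro h
    have : ∀ i, lam i = 0 := fun i => le_antisymm ((hσ i).trans_eq h) (hnonneg i)
    simp [this] at hnorm
  have hex : (∃ i, lam i = 0) ↔ lam (σ 0) = 0 ∨ lam (σ 1) = 0 := by
    refine ⟨fun ⟨i, hi⟩ => ?_, fun h => h.elim (fun h => ⟨_, h⟩) fun h => ⟨_, h⟩⟩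
    obtain ⟨k, rfl⟩ := σ.surjective i
    fin_cases k
    exacts [Or.inl hi, Or.inr hi, absurd hi hpos]
  rw [minimalControlPower_eq hnonneg hnorm hσ, controlPower_generalizedW hnorm, hex,
    mul_eq_zero, binaryEntropy_eq_zero]
  have h0 := sq_nonneg (lam (σ 0))
  have h1 := sq_nonneg (lam (σ 1))
  constructor
  · rintro (h | h | h)
    · exact Or.inl (pow_eq_zero_iff two_ne_zero |>.mp (by linarith))
    · rcases div_eq_zero_iff.mp h with h | h
      · exact Or.inl (pow_eq_zero_iff two_ne_zero |>.mp h)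
      · exact Or.inl (pow_eq_zero_iff two_ne_zero |>.mp (by linarith))
    · rw [div_eq_one_iff_eq (fun h' => by simp [h'] at h)] at h
      exact Or.inr (pow_eq_zero_iff two_ne_zero |>.mp (by linarith))
  · rintro (h | h)
    · exact Or.inr (Or.inl (by simp [h]))
    · rcases eq_or_ne (lam (σ 0)) 0 with h' | h'
      · exact Or.inr (Or.inl (by simp [h']))
      · exact Or.inr (Or.inr (by simp [h, h']))

/-- If λ_j = 0, qubit j factors out as |0⟩. Conversely, in a product λ_jλ_k = φ₁χ₀₀φ₀χ₁₀ contains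
the factor φ₁χ₁₀, the amplitude of |110⟩, which is 0. -/
lemma exists_eq_zero_iff_isBiseparableOrFullySeparable (lam : Fin 3 → ℝ) :
    (∃ i, lam i = 0) ↔ IsBiseparableOrFullySeparable (generalizedW lam) := by
  constructor
  · rintro ⟨j, hj⟩
    refine ⟨Equiv.swap 0 j, Pi.single 0 1,
      fun a b => generalizedW (lam ∘ Equiv.swap 0 j) ![0, a, b], fun c a b => ?_⟩
    rw [generalizedW_label]
    have h0 : (lam ∘ Equiv.swap 0 j) 0 = 0 := by simp [hj]
    fin_cases c
    · simp
    · simp only [generalizedW_apply, h0]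
      simp
  · rintro ⟨σ, φ, χ, h⟩
    have h1 := h 1 0 0
    have h2 := h 0 1 0
    have h3 := h 1 1 0
    simp only [generalizedW_label, generalizedW_apply] at h1 h2 h3
    simp at h1 h2 h3
    have : (lam (σ 0) : ℂ) * lam (σ 1) = 0 := by
      rw [h1, h2]
      rcases h3 with h3 | h3 <;> simp [h3]
    rcases mul_eq_zero.mp this with h | h
    · exact ⟨σ 0, Complex.ofReal_eq_zero.mp h⟩
    · exact ⟨σ 1, Complex.ofReal_eq_zero.mp h⟩

end DenseCoding

theorem mainTheorem6 (lam : Fin 3 → ℝ) (hnonneg : ∀ i, 0 ≤ lam i)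
    (hnorm : ∑ i, lam i ^ 2 = 1) :
    -- the computational basis is an optimal measurement basis of the controller
    (∀ (σ : Equiv.Perm (Fin 3)) (U : Matrix.unitaryGroup (Fin 2) ℂ),
      DenseCoding.averageCapacity (DenseCoding.pureState (DenseCoding.generalizedW lam)) σ U ≤
        DenseCoding.averageCapacity (DenseCoding.pureState (DenseCoding.generalizedW lam)) σ 1) ∧
    -- the control powers
    (∀ σ : Equiv.Perm (Fin 3),
      DenseCoding.controlPower (DenseCoding.pureState (DenseCoding.generalizedW lam)) σ =
        (lam (σ 0) ^ 2 + lam (σ 1) ^ 2) *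
          DenseCoding.binaryEntropy (lam (σ 0) ^ 2 / (lam (σ 0) ^ 2 + lam (σ 1) ^ 2))) ∧
    -- the minimal control power is attained where the receiver has the largest coefficient
    (∀ σ : Equiv.Perm (Fin 3), (∀ i, lam i ≤ lam (σ 2)) →
      DenseCoding.minimalControlPower (DenseCoding.pureState (DenseCoding.generalizedW lam)) =
          DenseCoding.controlPower (DenseCoding.pureState (DenseCoding.generalizedW lam)) σ ∧
      DenseCoding.minimalControlPower (DenseCoding.pureState (DenseCoding.generalizedW lam)) =
        (lam (σ 0) ^ 2 + lam (σ 1) ^ 2) *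
          DenseCoding.binaryEntropy (lam (σ 0) ^ 2 / (lam (σ 0) ^ 2 + lam (σ 1) ^ 2))) ∧
    -- the minimal control power vanishes exactly if some coefficient does
    (DenseCoding.minimalControlPower (DenseCoding.pureState (DenseCoding.generalizedW lam)) = 0 ↔
      ∃ i, lam i = 0) ∧
    -- which means exactly that the state is biseparable or fully separable
    ((∃ i, lam i = 0) ↔
      DenseCoding.IsBiseparableOrFullySeparable (DenseCoding.generalizedW lam)) := by
  open DenseCoding in
  exact ⟨fun σ U => (averageCapacity_le hnorm σ U.2).trans_eq (averageCapacity_one hnorm σ).symm,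
    controlPower_generalizedW hnorm,
    fun σ hσ => ⟨minimalControlPower_eq hnonneg hnorm hσ,
      (minimalControlPower_eq hnonneg hnorm hσ).trans (controlPower_generalizedW hnorm σ)⟩,
    minimalControlPower_eq_zero_iff hnonneg hnorm,
    exists_eq_zero_iff_isBiseparableOrFullySeparable lam⟩
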